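/- Let $\mathbb{A}=(\mathbb{R}/\mathbb{Z})\times[0,1]$ be the closed annulus, $\widetilde{\mathbb{A}}=\mathbb{R}\times[0,1]$ its universal covering, and $T(\theta,t)=(\theta+1,t)$. An essential simple arc in $\widetilde{\mathbb{A}}$ is a simple arc which joins one boundary component of $\widetilde{\mathbb{A}}$ to the other and whose relative interior lies in the interior of $\widetilde{\mathbb{A}}$. For disjoint essential simple arcs $\Gamma_1,\Gamma_2$ we write $\Gamma_1<\Gamma_2$ if $\Gamma_2$ is on the right of $\Gamma_1$, i.e. if $\Gamma_2$ is contained in the connected component of $\widetilde{\mathbb{A}}\setminus\Gamma_1$ that is unbounded to the right. A Farey interval is an interval $\left]\frac{p}{q},\frac{p'}{q'}\right[$ with $p,p'\in\mathbb{Z}$, $q,q'\in\mathbb{N}\setminus\{0\}$ and $p'q-pq'=1$. **Proposition.** Let $h$ be a homeomorphism of $\mathbb{A}$ isotopic to the identity, let $\widetilde h$ be a lift of $h$ to $\widetilde{\mathbb{A}}$, and let $\Gamma\subset\widetilde{\mathbb{A}}$ be an essential simple arc. Assume that there is a Farey interval $\left]\frac{p}{q},\frac{p'}{q'}\right[$ such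 that $$T^{-p'}\circ\widetilde h^{q'}(\Gamma)<\Gamma<T^{-p}\circ\widetilde h^{q}(\Gamma).$$ Then: 1. the arcs $T^{-\ell}\circ\widetilde h^{k}(\Gamma)$, with $k\in\{0,\dots,q+q'-1\}$ and $\ell\in\mathbb{Z}$, are pairwise disjoint (for distinct pairs $(k,\ell)$); 2. for every $\alpha\in\left]\frac{p}{q},\frac{p'}{q'}\right[$ and all pairs $(k,\ell),(k',\ell')\in\{0,\dots,q+q'-1\}\times\mathbb{Z}$, $$T^{-\ell}\circ\widetilde h^{k}(\Gamma)<T^{-\ell'}\circ\widetilde h^{k'}(\Gamma)\iff k\alpha-\ell<k'\alpha-\ell'.$$ -/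

import Mathlib

namespace FareyArcs

/-- The closed annulus `S¹ × [0,1]`, where `S¹ = ℝ/ℤ`. -/
abbrev Annulus : Type := UnitAddCircle × unitInterval

/-- The band `ℝ × [0,1]`, universal covering of the annulus. -/
abbrev Band : Type := ℝ × unitInterval

/-- The canonical projection of the band onto the annulus. -/
def proj (z : Band) : Annulus := ((z.1 : UnitAddCircle), z.2)

/-- The translation `T (θ, t) = (θ + 1, t)` of the band. Its integer powers are taken in the
group of homeomorphisms of the band. -/
def T : Band ≃ₜ Band := (Homeomorph.addRight (1 : ℝ)).prodCongr (Homeomorph.refl unitInterval)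

theorem T_apply (z : Band) : T z = (z.1 + 1, z.2) := rfl

theorem T_zpow_apply (n : ℤ) (z : Band) : (T ^ n) z = (z.1 + n, z.2) := by
  induction n with
  | zero => simp
  | succ n ih =>
    rw [zpow_add_one, ← (Commute.zpow_self T n).eq.symm, Homeomorph.mul_apply, ih, T_apply]
    ext <;> simp [add_assoc]
  | pred n ih =>
    have h : T ((T ^ (-(n : ℤ) - 1)) z) = (T ^ (-(n : ℤ))) z := by
      rw [← Homeomorph.mul_apply, ← zpow_one_add]
      congr 2
      ring
    rw [ih] at h
    apply T.injective
    rw [h, T_apply]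
    ext
    · push_cast
      ring
    · rfl

/-- A homeomorphism `h` of the annulus is isotopic to the identity: it is joined to the identity
by a continuous path of homeomorphisms of the annulus. -/
def IsotopicToId (h : Annulus ≃ₜ Annulus) : Prop :=
  ∃ H : unitInterval × Annulus → Annulus, Continuous H ∧
    (∀ z, H (0, z) = z) ∧ (∀ z, H (1, z) = h z) ∧
    ∀ t, IsHomeomorph (fun z => H (t, z))

/-- `g` is a lift to the band of the homeomorphism `h` of the annulus. -/
def IsLift (g : Band → Band) (h : Annulus ≃ₜ Annulus) : Prop :=
  Continuous g ∧ ∀ z, proj (g z) = h (proj z)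

/-- `Γ` is (the image of) an essential simple arc of the band: a simple arc that joins one boundary
component to the other one and whose relative interior lies in the interior of the band. The
parametrization is chosen to go from the lower to the upper boundary component. -/
def IsEssentialArc (Γ : Set Band) : Prop :=
  ∃ γ : unitInterval → Band, Continuous γ ∧ Function.Injective γ ∧ Set.range γ = Γ ∧
    (γ 0).2 = 0 ∧ (γ 1).2 = 1 ∧
    ∀ s : unitInterval, 0 < s → s < 1 → 0 < (γ s).2 ∧ (γ s).2 < 1

/-- The part of the band on the right of `Γ`: the points of the complement of `Γ` whose connected
component in that complement is unbounded to the right. (The component of a point of `Γ` in the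
complement is empty by convention, so such a point does not belong to `rightOf Γ`. If `Γ` is an
essential simple arc then `rightOf Γ` is one single component of the complement.) -/
def rightOf (Γ : Set Band) : Set Band :=
  {z | ¬ BddAbove (Prod.fst '' connectedComponentIn Γᶜ z)}

/-- `Γ₁ < Γ₂`: the arc `Γ₂` is on the right of `Γ₁` (in particular it is disjoint from `Γ₁`). -/
def ArcLT (Γ₁ Γ₂ : Set Band) : Prop := Γ₂ ⊆ rightOf Γ₁

/-- The set `T ^ (-ℓ) (g ^ k (Γ))`. -/
def iterArc (g : Band → Band) (Γ : Set Band) (k : ℕ) (ℓ : ℤ) : Set Band :=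
  (fun z => (T ^ (-ℓ)) (g^[k] z)) '' Γ

/-- `]p/q, p'/q'[` is a Farey interval (the fractions are then automatically irreducible). -/
def IsFareyInterval (p : ℤ) (q : ℕ) (p' : ℤ) (q' : ℕ) : Prop :=
  0 < q ∧ 0 < q' ∧ p' * q - p * q' = 1

end FareyArcs

/-!
The lift `g` is a homeomorphism commuting with `T` (`IsLift.exists_homeomorph`), so `ℤ²` acts on the
band by `gridMap G a b = T ^ (-b) ∘ G ^ a`. A homeomorphism commuting with `T` is at bounded distance
from the identity, hence maps components unbounded to the right to such components and preserves the
relation `ArcLT` (`ArcLT.image`).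

The topological content is that `ArcLT` is a strict order on the images of `Γ`. It is proved for
*barriers*, nonempty compact connected sets which separate the two ends of the band: if two barriers
were on the right of each other, their left sides would coincide and be closed and open
(`ArcLT.asymm`), and transitivity follows (`ArcLT.trans`). An essential arc is a barrier because two
crossing paths in a strip meet (`exists_eq_of_crossing`), which is proved with a continuous logarithm
of the difference of the paths. Barriers, unlike essential arcs, are visibly preserved by the
homeomorphisms commuting with `T`, so nothing has to be said on the boundary of the band.

The rest is arithmetic. The hypotheses say that the vectors `(q, p)` and `(-q', -p')` move `Γ` to
the right, so every nonzero vector of the cone they generate does (`arcLT_gridMap_nsmul_add`).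
They form a basis of `ℤ²` by the Farey condition, and the difference of two indices
`k, k' ≤ q + q' - 1` is so small that the coordinates of `(k' - k, ℓ' - ℓ)` have the same sign
(`exists_nat_coords`). So two distinct iterates are comparable, in the order given by the affine form
`a α - b`, which is positive on the generators of the cone.
-/

/-! ### Paths crossing a square -/

namespace FareyArcs

open unitInterval in
/-- Two paths in a horizontal strip, one going from the bottom line to the top line and the other
one passing from the left of the first path to the right of it, must meet. Otherwise the difference
of the two paths would have a continuous logarithm on the square; its imaginary part lies in
`(-π/2, π/2)` on the first side of the square, avoids `π/2` on the second and `-π/2` on the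
third, and avoids `[-π/2, π/2]` on the last, which is incompatible with the intermediate value
theorem. -/
theorem exists_eq_of_crossing {γ δ : I → ℝ × ℝ} (hγ : Continuous γ) (hδ : Continuous δ)
    (hbot : ∀ t, (γ 0).2 ≤ (δ t).2) (htop : ∀ t, (δ t).2 ≤ (γ 1).2)
    (hleft : ∀ s, (δ 0).1 < (γ s).1) (hright : ∀ s, (γ s).1 < (δ 1).1) :
    ∃ s t, γ s = δ t := by
  by_contra! hne
  have hF0 (t s : I) : (⟨(γ s).1 - (δ t).1, (γ s).2 - (δ t).2⟩ : ℂ) ≠ 0 := fun h0 =>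
    hne s t (Prod.ext (sub_eq_zero.1 (congrArg Complex.re h0))
      (sub_eq_zero.1 (congrArg Complex.im h0)))
  let F : C(I × I, {z : ℂ // z ≠ 0}) :=
    ⟨fun x => ⟨⟨(γ x.2).1 - (δ x.1).1, (γ x.2).2 - (δ x.1).2⟩, hF0 x.1 x.2⟩, by
      refine Continuous.subtype_mk ?_ _
      have : (fun x : I × I => (⟨(γ x.2).1 - (δ x.1).1, (γ x.2).2 - (δ x.1).2⟩ : ℂ)) =
          fun x => Complex.equivRealProdCLM.symm (γ x.2 - δ x.1) := by
        funext x
        exact Complex.ext rfl rfl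
      rw [this]
      fun_prop⟩
  -- The half plane `0 < re z` carries the principal logarithm: it starts the lift of `F`.
  let f : C(I, ℂ) := ⟨fun s => Complex.log (F (0, s)).1, by
    refine Continuous.clog (by fun_prop) fun s => ?_
    exact Or.inl (sub_pos.2 (hleft s))⟩
  have hf (s : I) : F (0, s) = ⟨_, (f s).exp_ne_zero⟩ :=
    Subtype.ext (Complex.exp_log (F (0, s)).2).symm
  let K := Complex.isCoveringMap_exp.liftHomotopy F f hf
  let θ : I × I → ℝ := fun x => (K x).im
  have hθ : Continuous θ := Complex.continuous_im.comp K.continuous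
  have hK (x : I × I) : Complex.exp (K x) = (F x).1 :=
    congrArg Subtype.val (congrFun (Complex.isCoveringMap_exp.liftHomotopy_lifts F f hf) x)
  have hcos (t s : I) : Real.exp (K (t, s)).re * Real.cos (θ (t, s)) = (γ s).1 - (δ t).1 := by
    have := congrArg Complex.re (hK (t, s))
    rwa [Complex.exp_re] at this
  have hsin (t s : I) : Real.exp (K (t, s)).re * Real.sin (θ (t, s)) = (γ s).2 - (δ t).2 := by
    have := congrArg Complex.im (hK (t, s))
    rwa [Complex.exp_im] at this
  have hstart (s : I) : |θ (0, s)| < Real.pi / 2 := by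
    have h1 : K (0, s) = f s := Complex.isCoveringMap_exp.liftHomotopy_zero F f hf s
    change |(K (0, s)).im| < _
    rw [h1]
    change |(Complex.log (F (0, s)).1).im| < _
    rw [Complex.log_im, Complex.abs_arg_lt_pi_div_two_iff]
    exact Or.inl (sub_pos.2 (hleft s))
  have hpi := Real.pi_pos
  have h01 : θ (1, 0) < Real.pi / 2 := by
    by_contra! hc
    obtain ⟨t, ht⟩ := mem_range_of_exists_le_of_exists_ge (c := Real.pi / 2)
      (f := fun t : I => θ (t, 0)) (by fun_prop) ⟨0, (abs_lt.1 (hstart 0)).2.le⟩ ⟨1, hc⟩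
    have h1 := hsin t 0
    rw [show θ (t, 0) = Real.pi / 2 from ht, Real.sin_pi_div_two] at h1
    have := hbot t
    have := Real.exp_pos (K (t, 0)).re
    linarith
  have h11 : -(Real.pi / 2) < θ (1, 1) := by
    by_contra! hc
    obtain ⟨t, ht⟩ := mem_range_of_exists_le_of_exists_ge (c := -(Real.pi / 2))
      (f := fun t : I => θ (t, 1)) (by fun_prop) ⟨1, hc⟩ ⟨0, (abs_lt.1 (hstart 1)).1.le⟩
    have h1 := hsin t 1
    rw [show θ (t, 1) = -(Real.pi / 2) from ht, Real.sin_neg, Real.sin_pi_div_two] at h1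
    have := htop t
    have := Real.exp_pos (K (t, 1)).re
    linarith
  have hcosneg (s : I) : Real.cos (θ (1, s)) < 0 := by
    have h1 := hcos 1 s
    have := hright s
    have := Real.exp_pos (K (1, s)).re
    by_contra! hc
    nlinarith [mul_nonneg this.le hc]
  have h01' : θ (1, 0) < -(Real.pi / 2) := by
    by_contra! hc
    exact (hcosneg 0).not_ge (Real.cos_nonneg_of_mem_Icc ⟨hc, h01.le⟩)
  obtain ⟨s, hs⟩ := mem_range_of_exists_le_of_exists_ge (c := -(Real.pi / 2))
    (f := fun s : I => θ (1, s)) (by fun_prop) ⟨0, h01'.le⟩ ⟨1, h11.le⟩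
  refine (hcosneg s).ne ?_
  rw [show θ (1, s) = -(Real.pi / 2) from hs, Real.cos_neg, Real.cos_pi_div_two]

/-! ### Barriers and the order on them -/

open Set Topology

instance : LocallyPathConnectedSpace unitInterval :=
  (isQuotientMap_projIcc (h := zero_le_one' ℝ)).locallyPathConnectedSpace

/-- The points of the complement of `C` whose connected component in that complement is unbounded
to the left. -/
def leftOf (C : Set Band) : Set Band :=
  {z | ¬ BddBelow (Prod.fst '' connectedComponentIn Cᶜ z)}

/-- A barrier is a nonempty compact connected subset of the band which separates the left end of
the band from the right end: no component of its complement is unbounded on both sides. -/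
structure IsBarrier (C : Set Band) : Prop where
  isCompact : IsCompact C
  isConnected : IsConnected C
  disjoint : Disjoint (leftOf C) (rightOf C)

theorem rightOf_subset_compl (C : Set Band) : rightOf C ⊆ Cᶜ := by
  intro z hz hzC
  have hemp : connectedComponentIn Cᶜ z = ∅ := connectedComponentIn_eq_empty fun hc => hc hzC
  exact hz (by rw [hemp, image_empty]; simp)

theorem leftOf_subset_compl (C : Set Band) : leftOf C ⊆ Cᶜ := by
  intro z hz hzC
  have hemp : connectedComponentIn Cᶜ z = ∅ := connectedComponentIn_eq_empty fun hc => hc hzC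
  exact hz (by rw [hemp, image_empty]; simp)

theorem mem_rightOf_of_mem_component {C : Set Band} {z w : Band} (hz : z ∈ rightOf C)
    (hw : w ∈ connectedComponentIn Cᶜ z) : w ∈ rightOf C := by
  rw [rightOf, mem_ofPred_eq, ← connectedComponentIn_eq hw]
  exact hz

theorem mem_leftOf_of_mem_component {C : Set Band} {z w : Band} (hz : z ∈ leftOf C)
    (hw : w ∈ connectedComponentIn Cᶜ z) : w ∈ leftOf C := by
  rw [leftOf, mem_ofPred_eq, ← connectedComponentIn_eq hw]
  exact hz

theorem isPreconnected_leftRay (m : ℝ) : IsPreconnected {z : Band | z.1 ≤ m} := by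
  have : {z : Band | z.1 ≤ m} = Iic m ×ˢ univ := by ext; simp
  rw [this]
  exact isPreconnected_Iic.prod isPreconnected_univ

/-- The left side of a set bounded on the left is one single component of the complement: any
component unbounded to the left contains the far left part of the band, which is connected. -/
theorem mem_component_of_mem_leftOf {C : Set Band} {m : ℝ} (hm : ∀ z ∈ C, m < z.1)
    {z : Band} (hz : z ∈ leftOf C) {w : Band} (hw : w.1 ≤ m) : z ∈ connectedComponentIn Cᶜ w := by
  have hsub : {z : Band | z.1 ≤ m} ⊆ Cᶜ := fun x hx hxC => (hm x hxC).not_ge hx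
  have hn : ∃ x ∈ connectedComponentIn Cᶜ z, x.1 ≤ m := by
    by_contra! h
    exact hz ⟨m, by rintro _ ⟨x, hx, rfl⟩; exact (h x hx).le⟩
  obtain ⟨x, hx, hxm⟩ := hn
  have h1 : x ∈ connectedComponentIn Cᶜ w :=
    (isPreconnected_leftRay m).subset_connectedComponentIn hw hsub hxm
  rw [connectedComponentIn_eq h1, ← connectedComponentIn_eq hx]
  exact mem_connectedComponentIn (leftOf_subset_compl C hz)

theorem mem_leftOf_of_le {C : Set Band} {m : ℝ} (hm : ∀ z ∈ C, m < z.1) {w : Band}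
    (hw : w.1 ≤ m) : w ∈ leftOf C := by
  have hsub : {z : Band | z.1 ≤ m} ⊆ Cᶜ := fun x hx hxC => (hm x hxC).not_ge hx
  have h1 := (isPreconnected_leftRay m).subset_connectedComponentIn hw hsub
  rintro ⟨b, hb⟩
  have : b ≤ min m (b - 1) := hb ⟨(min m (b - 1), 0), h1 (min_le_left m (b - 1)), rfl⟩
  have := min_le_right m (b - 1)
  linarith

theorem exists_forall_lt_fst {C : Set Band} (hC : IsCompact C) :
    ∃ m : ℝ, ∀ z ∈ C, m < z.1 := by
  obtain ⟨b, hb⟩ := (hC.image continuous_fst).bddBelow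
  exact ⟨b - 1, fun z hz => by have := hb ⟨z, hz, rfl⟩; linarith⟩

theorem isOpen_leftOf {C : Set Band} (hC : IsClosed C) : IsOpen (leftOf C) := by
  rw [isOpen_iff_mem_nhds]
  intro z hz
  exact Filter.mem_of_superset
    (connectedComponentIn_mem_nhds (hC.isOpen_compl.mem_nhds (leftOf_subset_compl C hz)))
    fun w hw => mem_leftOf_of_mem_component hz hw

theorem mem_leftOf_of_mem_closure {C : Set Band} (hC : IsClosed C) {z : Band} (hzC : z ∉ C)
    (hz : z ∈ closure (leftOf C)) : z ∈ leftOf C := by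
  obtain ⟨w, hw, hwL⟩ := mem_closure_iff_nhds.1 hz _
    (connectedComponentIn_mem_nhds (hC.isOpen_compl.mem_nhds hzC))
  refine mem_leftOf_of_mem_component hwL ?_
  rw [← connectedComponentIn_eq hw]
  exact mem_connectedComponentIn hzC

/-- The left side of `C` is connected and misses `D`, which lies on the right of `C`. -/
theorem leftOf_subset_leftOf {C D : Set Band} (hC : IsBarrier C) (hD : IsBarrier D)
    (hCD : ArcLT C D) : leftOf C ⊆ leftOf D := by
  obtain ⟨m, hm⟩ := exists_forall_lt_fst (hC.isCompact.union hD.isCompact)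
  have hmC : ∀ z ∈ C, m < z.1 := fun z hz => hm z (Or.inl hz)
  have hmD : ∀ z ∈ D, m < z.1 := fun z hz => hm z (Or.inr hz)
  have hw : ((m, 0) : Band).1 ≤ m := le_rfl
  have hwC := mem_leftOf_of_le hmC hw
  have hsub : connectedComponentIn Cᶜ (m, 0) ⊆ Dᶜ := fun x hx hxD =>
    disjoint_left.1 hC.disjoint (mem_leftOf_of_mem_component hwC hx) (hCD hxD)
  intro z hz
  refine mem_leftOf_of_mem_component (mem_leftOf_of_le hmD hw) ?_
  exact isPreconnected_connectedComponentIn.subset_connectedComponentIn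
    (mem_connectedComponentIn (leftOf_subset_compl C hwC)) hsub
    (mem_component_of_mem_leftOf hmC hz hw)

/-- Two barriers cannot lie on the right of each other: their left sides would coincide, and the
common left side would have its frontier in both barriers, hence be closed and open. -/
theorem ArcLT.asymm {C D : Set Band} (hC : IsBarrier C) (hD : IsBarrier D)
    (hCD : ArcLT C D) : ¬ ArcLT D C := by
  intro hDC
  have heq : leftOf C = leftOf D :=
    (leftOf_subset_leftOf hC hD hCD).antisymm (leftOf_subset_leftOf hD hC hDC)
  have hclosed : IsClosed (leftOf C) := by
    refine isClosed_of_closure_subset fun z hz => ?_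
    by_cases hzC : z ∈ C
    · have hzD : z ∉ D := fun hzD => rightOf_subset_compl C (hCD hzD) hzC
      rw [heq] at hz ⊢
      exact mem_leftOf_of_mem_closure hD.isCompact.isClosed hzD hz
    · exact mem_leftOf_of_mem_closure hC.isCompact.isClosed hzC hz
  obtain ⟨m, hm⟩ := exists_forall_lt_fst hC.isCompact
  have huniv : leftOf C = univ :=
    IsClopen.eq_univ ⟨hclosed, isOpen_leftOf hC.isCompact.isClosed⟩
      ⟨(m, 0), mem_leftOf_of_le hm le_rfl⟩
  obtain ⟨c, hc⟩ := hC.isConnected.nonempty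
  exact leftOf_subset_compl C (huniv ▸ mem_univ c) hc

theorem not_arcLT_self {C : Set Band} (hC : C.Nonempty) : ¬ ArcLT C C := by
  intro h
  obtain ⟨c, hc⟩ := hC
  exact rightOf_subset_compl C (h hc) hc

theorem ArcLT.disjoint {C D : Set Band} (h : ArcLT C D) : Disjoint C D :=
  disjoint_left.2 fun _ hC hD => rightOf_subset_compl C (h hD) hC

/-- The first barrier is connected and, by asymmetry, not contained in the right side of the second
one, so it misses that right side, which is then contained in the right side of the first. -/
theorem ArcLT.trans {C D E : Set Band} (hC : IsBarrier C) (hD : IsBarrier D)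
    (hCD : ArcLT C D) (hDE : ArcLT D E) : ArcLT C E := by
  have hdisj : Disjoint C (rightOf D) := by
    rw [disjoint_left]
    intro c hc hcD
    refine ArcLT.asymm hC hD hCD fun x hx => mem_rightOf_of_mem_component hcD ?_
    exact hC.isConnected.isPreconnected.subset_connectedComponentIn hc
      hCD.disjoint.subset_compl_right hx
  intro z hz
  have hzD := hDE hz
  have hsub : connectedComponentIn Dᶜ z ⊆ connectedComponentIn Cᶜ z :=
    isPreconnected_connectedComponentIn.subset_connectedComponentIn
      (mem_connectedComponentIn (rightOf_subset_compl D hzD))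
      fun x hx hxC => disjoint_left.1 hdisj hxC (mem_rightOf_of_mem_component hzD hx)
  exact fun hb => hzD (hb.mono (image_mono hsub))

/-! ### Essential arcs are barriers -/

/-- A component unbounded on both sides would contain a path from the left of the arc to its
right. -/
theorem IsEssentialArc.isBarrier {Γ : Set Band} (hΓ : IsEssentialArc Γ) : IsBarrier Γ := by
  obtain ⟨γ, hγ, -, rfl, h0, h1, -⟩ := hΓ
  have hcomp : IsCompact (range γ) := isCompact_range hγ
  refine ⟨hcomp, isConnected_range hγ, ?_⟩
  rw [disjoint_left]
  intro z hzl hzr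
  obtain ⟨a, ha⟩ := (hcomp.image continuous_fst).bddBelow
  obtain ⟨b, hb⟩ := (hcomp.image continuous_fst).bddAbove
  have hl : ∃ x ∈ connectedComponentIn (range γ)ᶜ z, x.1 < a := by
    by_contra! h
    exact hzl ⟨a, by rintro _ ⟨x, hx, rfl⟩; exact h x hx⟩
  have hr : ∃ x ∈ connectedComponentIn (range γ)ᶜ z, b < x.1 := by
    by_contra! h
    exact hzr ⟨b, by rintro _ ⟨x, hx, rfl⟩; exact h x hx⟩
  obtain ⟨x, hx, hxa⟩ := hl
  obtain ⟨y, hy, hyb⟩ := hr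
  have hconn : IsConnected (connectedComponentIn (range γ)ᶜ z) :=
    isConnected_connectedComponentIn_iff.2 (leftOf_subset_compl _ hzl)
  have hopen := hcomp.isClosed.isOpen_compl.connectedComponentIn (x := z)
  obtain ⟨δ, hδ⟩ := (hopen.isConnected_iff_isPathConnected.1 hconn).joinedIn x hx y hy
  have hc : Continuous fun w : Band => ((w.1, (w.2 : ℝ)) : ℝ × ℝ) := by fun_prop
  obtain ⟨s, t, hst⟩ := exists_eq_of_crossing (hc.comp hγ) (hc.comp δ.continuous)
    (fun t => by simpa [h0] using (δ t).2.2.1) (fun t => by simpa [h1] using (δ t).2.2.2)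
    (fun s => by simpa using hxa.trans_le (ha ⟨_, ⟨s, rfl⟩, rfl⟩))
    (fun s => by simpa using (hb ⟨_, ⟨s, rfl⟩, rfl⟩ : (γ s).1 ≤ b).trans_lt hyb)
  refine connectedComponentIn_subset _ _ (hδ t) ⟨s, ?_⟩
  obtain ⟨h2, h3⟩ := Prod.mk.inj hst
  exact Prod.ext h2 (Subtype.ext h3)

/-! ### Homeomorphisms that commute with the translation -/

theorem fst_zpow_apply_of_commute {φ : Band ≃ₜ Band} (hφ : Commute φ T) (n : ℤ) (z : Band) :
    φ (z.1 + n, z.2) = ((φ z).1 + n, (φ z).2) := by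
  have h : φ ((T ^ n) z) = (T ^ n) (φ z) := DFunLike.congr_fun (hφ.zpow_right n).eq z
  rwa [T_zpow_apply, T_zpow_apply] at h

/-- A homeomorphism that commutes with the translation is at bounded distance from the
identity. -/
theorem exists_abs_fst_sub_le {φ : Band ≃ₜ Band} (hφ : Commute φ T) :
    ∃ M : ℝ, ∀ z, |(φ z).1 - z.1| ≤ M := by
  obtain ⟨M, hM⟩ := ((isCompact_Icc (a := (0 : ℝ)) (b := 1)).prod
    (isCompact_univ (X := unitInterval))).exists_bound_of_continuousOn
    (f := fun z : Band => (φ z).1 - z.1) (by have := φ.continuous; fun_prop)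
  refine ⟨M, fun z => ?_⟩
  have h := hM (Int.fract z.1, z.2)
    ⟨⟨Int.fract_nonneg _, (Int.fract_lt_one _).le⟩, mem_univ _⟩
  have h2 := fst_zpow_apply_of_commute hφ ⌊z.1⌋ (Int.fract z.1, z.2)
  simp only [Int.fract_add_floor] at h2
  rw [show φ z = _ from h2]
  rw [Real.norm_eq_abs] at h
  convert h using 2
  simp only [Int.fract]
  ring

theorem bddAbove_fst_image {φ : Band ≃ₜ Band} (hφ : Commute φ T) {S : Set Band}
    (hS : BddAbove (Prod.fst '' S)) : BddAbove (Prod.fst '' (φ '' S)) := by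
  obtain ⟨M, hM⟩ := exists_abs_fst_sub_le hφ
  obtain ⟨b, hb⟩ := hS
  refine ⟨b + M, ?_⟩
  rintro _ ⟨_, ⟨z, hz, rfl⟩, rfl⟩
  have := hb ⟨z, hz, rfl⟩
  have := (abs_le.1 (hM z)).2
  linarith

theorem bddBelow_fst_image {φ : Band ≃ₜ Band} (hφ : Commute φ T) {S : Set Band}
    (hS : BddBelow (Prod.fst '' S)) : BddBelow (Prod.fst '' (φ '' S)) := by
  obtain ⟨M, hM⟩ := exists_abs_fst_sub_le hφ
  obtain ⟨b, hb⟩ := hS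
  refine ⟨b - M, ?_⟩
  rintro _ ⟨_, ⟨z, hz, rfl⟩, rfl⟩
  have := hb ⟨z, hz, rfl⟩
  have := (abs_le.1 (hM z)).1
  linarith

theorem image_component_compl (φ : Band ≃ₜ Band) (C : Set Band) (z : Band) :
    φ '' connectedComponentIn Cᶜ z = connectedComponentIn (φ '' C)ᶜ (φ z) := by
  by_cases hz : z ∈ C
  · have h1 : connectedComponentIn Cᶜ z = ∅ := connectedComponentIn_eq_empty fun hc => hc hz
    have h2 : connectedComponentIn (φ '' C)ᶜ (φ z) = ∅ :=
      connectedComponentIn_eq_empty fun hc => hc (mem_image_of_mem φ hz)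
    rw [h1, h2, image_empty]
  · rw [φ.image_connectedComponentIn hz, image_compl_eq φ.bijective]

theorem mem_rightOf_of_apply_mem {φ : Band ≃ₜ Band} (hφ : Commute φ T) {C : Set Band} {z : Band}
    (hz : φ z ∈ rightOf (φ '' C)) : z ∈ rightOf C := fun hb =>
  hz (image_component_compl φ C z ▸ bddAbove_fst_image hφ hb)

theorem mem_leftOf_of_apply_mem {φ : Band ≃ₜ Band} (hφ : Commute φ T) {C : Set Band} {z : Band}
    (hz : φ z ∈ leftOf (φ '' C)) : z ∈ leftOf C := fun hb =>
  hz (image_component_compl φ C z ▸ bddBelow_fst_image hφ hb)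

theorem inv_image_image (φ : Band ≃ₜ Band) (C : Set Band) : (φ⁻¹ : Band ≃ₜ Band) '' (φ '' C) = C :=
  φ.toEquiv.symm_image_image C

theorem ArcLT.image {φ : Band ≃ₜ Band} (hφ : Commute φ T) {C D : Set Band} (h : ArcLT C D) :
    ArcLT (φ '' C) (φ '' D) := by
  rintro _ ⟨z, hz, rfl⟩
  refine mem_rightOf_of_apply_mem (φ := φ⁻¹) hφ.inv_left ?_
  rw [inv_image_image]
  exact (φ.symm_apply_apply z).symm ▸ h hz

theorem IsBarrier.image {φ : Band ≃ₜ Band} (hφ : Commute φ T) {C : Set Band} (h : IsBarrier C) :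
    IsBarrier (φ '' C) := by
  refine ⟨h.isCompact.image φ.continuous, h.isConnected.image _ φ.continuous.continuousOn, ?_⟩
  rw [disjoint_left]
  intro w hl hr
  obtain ⟨z, rfl⟩ := φ.surjective w
  exact disjoint_left.1 h.disjoint (mem_leftOf_of_apply_mem hφ hl) (mem_rightOf_of_apply_mem hφ hr)

/-! ### Lifts of homeomorphisms isotopic to the identity -/

/-- A lift of a homeomorphism isotopic to the identity commutes with the translation. The isotopy
lifts to the band, starting at the identity; at each time the lifted isotopy commutes with the
translation, since it does so at time zero, and `g` differs from its final map by an integer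
translation. -/
theorem IsLift.apply_T {h : Annulus ≃ₜ Annulus} (hh : IsotopicToId h) {g : Band → Band}
    (hg : IsLift g h) (z : Band) : g (T z) = T (g z) := by
  obtain ⟨H, hH, H0, H1, -⟩ := hh
  have hproj : Continuous proj := by unfold proj; fun_prop
  have hprojT (z : Band) : proj (T z) = proj z :=
    Prod.ext (AddCircle.coe_add_period 1 z.1) rfl
  have cov : IsCoveringMap ((↑) : ℝ → UnitAddCircle) := AddCircle.isCoveringMap_coe 1
  let F : C(unitInterval × Band, UnitAddCircle) :=
    ⟨fun x => (H (x.1, proj x.2)).1, by fun_prop⟩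
  let f : C(Band, ℝ) := ⟨Prod.fst, continuous_fst⟩
  have hf (z : Band) : F (0, z) = (f z : UnitAddCircle) := congrArg Prod.fst (H0 (proj z))
  let K := cov.liftHomotopy F f hf
  have hK (t : unitInterval) (z : Band) : (K (t, z) : UnitAddCircle) = (H (t, proj z)).1 :=
    congrFun (cov.liftHomotopy_lifts F f hf) (t, z)
  have hK0 (z : Band) : K (0, z) = z.1 := cov.liftHomotopy_zero F f hf z
  have hKT : K (1, T z) = K (1, z) + 1 := by
    refine congrFun (cov.eq_of_comp_eq (g₁ := fun t : unitInterval => K (t, T z))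
      (g₂ := fun t : unitInterval => K (t, z) + 1) (by fun_prop) (by fun_prop) ?_ 0 ?_) 1
    · funext t
      change (K (t, T z) : UnitAddCircle) = ((K (t, z) + 1 : ℝ) : UnitAddCircle)
      rw [AddCircle.coe_add_period, hK, hK, hprojT]
    · rw [hK0, hK0, T_apply]
  have hg1 (w : Band) : ((g w).1 : UnitAddCircle) = K (1, w) := by
    rw [hK, H1]
    exact congrArg Prod.fst (hg.2 w)
  have hgK : (fun w : Band => (g w).1) = fun w => K (1, w) + ((g z).1 - K (1, z)) := by
    have hgc := hg.1
    refine cov.eq_of_comp_eq (by fun_prop) (by fun_prop) ?_ z (by ring)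
    funext w
    change ((g w).1 : UnitAddCircle) = ((K (1, w) + ((g z).1 - K (1, z)) : ℝ) : UnitAddCircle)
    rw [AddCircle.coe_add, AddCircle.coe_sub, hg1, hg1, sub_self, add_zero]
  refine Prod.ext ?_ ?_
  · have h1 : (g (T z)).1 = _ := congrFun hgK (T z)
    rw [h1, hKT, T_apply]
    ring
  · have h1 : proj (g (T z)) = proj (g z) := by rw [hg.2, hg.2, hprojT]
    exact congrArg (fun a : Annulus => a.2) h1

theorem exists_zpow_apply_eq_of_proj_eq {z w : Band} (hzw : proj z = proj w) :
    ∃ n : ℤ, w = (T ^ n) z := by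
  have h1 : (z.1 : UnitAddCircle) = w.1 := congrArg Prod.fst hzw
  obtain ⟨n, hn⟩ := (AddCircle.coe_eq_zero_iff (1 : ℝ) (x := w.1 - z.1)).1
    (by rw [AddCircle.coe_sub, h1, sub_self])
  refine ⟨n, ?_⟩
  rw [T_zpow_apply]
  refine Prod.ext ?_ (congrArg Prod.snd hzw).symm
  rw [zsmul_one] at hn
  rw [hn]
  ring

theorem isLocalHomeomorph_proj : IsLocalHomeomorph proj := by
  refine IsLocalHomeomorph.mk _ fun z => ?_
  obtain ⟨e, he, hfe⟩ := AddCircle.isLocalHomeomorph_coe (1 : ℝ) z.1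
  refine ⟨e.prod (OpenPartialHomeomorph.refl unitInterval), ⟨he, mem_univ _⟩, fun w _ => ?_⟩
  exact Prod.ext (congrFun hfe w.1) rfl

/-- A lift of a homeomorphism isotopic to the identity is a homeomorphism of the band. -/
theorem IsLift.exists_homeomorph {h : Annulus ≃ₜ Annulus} (hh : IsotopicToId h) {g : Band → Band}
    (hg : IsLift g h) : ∃ G : Band ≃ₜ Band, ⇑G = g ∧ Commute G T := by
  have hT (n : ℤ) (z : Band) : g ((T ^ n) z) = (T ^ n) (g z) := by
    have h1 : Function.Semiconj g T T := hg.apply_T hh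
    induction n with
    | zero => rfl
    | succ n ih => rw [add_comm, zpow_add, zpow_one, Homeomorph.mul_apply, h1, ih]; rfl
    | pred n ih =>
      apply T.injective
      rw [← h1, ← Homeomorph.mul_apply, ← Homeomorph.mul_apply, ← zpow_one_add]
      rw [add_sub_cancel, ih]
  have hinj : Function.Injective g := by
    intro z w hzw
    obtain ⟨n, rfl⟩ := exists_zpow_apply_eq_of_proj_eq
      (h.injective ((hg.2 z).symm.trans ((congrArg proj hzw).trans (hg.2 w))))
    rw [hT, T_zpow_apply] at hzw
    have : (n : ℝ) = 0 := by simpa using congrArg Prod.fst hzw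
    rw [Int.cast_eq_zero.1 this]
    rfl
  have hsurj : Function.Surjective g := by
    intro w
    obtain ⟨y, hy⟩ := h.surjective (proj w)
    obtain ⟨x, hx⟩ := QuotientAddGroup.mk_surjective y.1
    have hz : proj (x, y.2) = y := Prod.ext hx rfl
    obtain ⟨n, rfl⟩ := exists_zpow_apply_eq_of_proj_eq (z := g (x, y.2)) (w := w)
      (by rw [hg.2, hz, hy])
    exact ⟨_, hT n _⟩
  have hloc : IsLocalHomeomorph g := by
    refine IsLocalHomeomorph.of_comp ?_ isLocalHomeomorph_proj hg.1
    rw [show proj ∘ g = h ∘ proj from funext hg.2]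
    exact h.isLocalHomeomorph.comp isLocalHomeomorph_proj
  exact ⟨(Equiv.ofBijective g ⟨hinj, hsurj⟩).toHomeomorphOfContinuousOpen hg.1 hloc.isOpenMap, rfl,
    Homeomorph.ext (hg.apply_T hh)⟩

/-! ### The action of `ℤ²` on the arcs -/

/-- The homeomorphism `T ^ (-b) ∘ G ^ a`, for integers `a` and `b`. -/
def gridMap (G : Band ≃ₜ Band) (a b : ℤ) : Band ≃ₜ Band := T ^ (-b) * G ^ a

theorem commute_gridMap {G : Band ≃ₜ Band} (hG : Commute G T) (a b : ℤ) :
    Commute (gridMap G a b) T :=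
  (Commute.zpow_self T _).mul_left (hG.zpow_left a)

theorem gridMap_add {G : Band ≃ₜ Band} (hG : Commute G T) (a b a' b' : ℤ) :
    gridMap G (a + a') (b + b') = gridMap G a b * gridMap G a' b' := by
  rw [gridMap, gridMap, gridMap, neg_add, zpow_add, zpow_add, mul_assoc, mul_assoc,
    ← mul_assoc (G ^ a), ((hG.zpow_left a).zpow_right (-b')).eq, mul_assoc]

theorem mul_image (φ ψ : Band ≃ₜ Band) (C : Set Band) : (φ * ψ) '' C = φ '' (ψ '' C) :=
  image_comp φ ψ C

theorem gridMap_zero_image (G : Band ≃ₜ Band) (C : Set Band) : gridMap G 0 0 '' C = C := by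
  have h : gridMap G 0 0 = 1 := by simp [gridMap]
  rw [h]
  exact image_id C

theorem iterArc_eq (G : Band ≃ₜ Band) (Γ : Set Band) (k : ℕ) (ℓ : ℤ) :
    iterArc G Γ k ℓ = gridMap G k ℓ '' Γ := by
  rw [gridMap, zpow_natCast]
  refine image_congr fun z _ => ?_
  rw [Homeomorph.mul_apply]
  congr 1
  induction k with
  | zero => rfl
  | succ k ih => rw [Function.iterate_succ_apply', ih, pow_succ', Homeomorph.mul_apply]

theorem arcLT_gridMap_add {G : Band ≃ₜ Band} (hG : Commute G T) {Γ : Set Band} (hΓ : IsBarrier Γ)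
    {a b a' b' : ℤ} (h : ArcLT Γ (gridMap G a b '' Γ)) (h' : ArcLT Γ (gridMap G a' b' '' Γ)) :
    ArcLT Γ (gridMap G (a + a') (b + b') '' Γ) := by
  rw [gridMap_add hG, mul_image]
  exact h.trans hΓ (hΓ.image (commute_gridMap hG a b)) (h'.image (commute_gridMap hG a b))

theorem arcLT_gridMap_nsmul_add {G : Band ≃ₜ Band} (hG : Commute G T) {Γ : Set Band}
    (hΓ : IsBarrier Γ) {a b a' b' : ℤ} (h : ArcLT Γ (gridMap G a b '' Γ))
    (h' : ArcLT Γ (gridMap G a' b' '' Γ)) (m n : ℕ) (hmn : 0 < m + n) :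
    ArcLT Γ (gridMap G (m * a + n * a') (m * b + n * b') '' Γ) := by
  have pos {c d : ℤ} (hcd : ArcLT Γ (gridMap G c d '' Γ)) (m : ℕ) (hm : 1 ≤ m) :
      ArcLT Γ (gridMap G (m * c) (m * d) '' Γ) := by
    induction m, hm using Nat.le_induction with
    | base => simpa using hcd
    | succ m _ ih =>
      have := arcLT_gridMap_add hG hΓ ih hcd
      push_cast
      rwa [add_one_mul, add_one_mul]
  rcases m.eq_zero_or_pos with rfl | hm
  · simpa using pos h' n (by omega)
  rcases n.eq_zero_or_pos with rfl | hn
  · simpa using pos h m hm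
  exact arcLT_gridMap_add hG hΓ (pos h m hm) (pos h' n hn)

/-- In the basis `(q, p)`, `(-q', -p')` of `ℤ²`, a vector whose first coordinate is smaller than
`q + q'` in absolute value has coordinates of the same sign: if they had opposite signs, the first
coordinate `m q - n q'` would be at least `q + q'` in absolute value. -/
theorem exists_nat_coords {p p' : ℤ} {q q' : ℕ} (hF : IsFareyInterval p q p' q') {a b : ℤ}
    (ha : |a| < q + q') (hab : (a, b) ≠ 0) :
    ∃ m n : ℕ, 0 < m + n ∧
      ((a = m * q + n * (-q') ∧ b = m * p + n * (-p')) ∨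
        (-a = m * q + n * (-q') ∧ -b = m * p + n * (-p'))) := by
  obtain ⟨hq, hq', hdet⟩ := hF
  obtain ⟨ha1, ha2⟩ := abs_lt.1 ha
  have hq : (0 : ℤ) < q := by exact_mod_cast hq
  have hq' : (0 : ℤ) < q' := by exact_mod_cast hq'
  obtain ⟨m, hm⟩ : ∃ m, m = p' * a - q' * b := ⟨_, rfl⟩
  obtain ⟨n, hn⟩ : ∃ n, n = p * a - q * b := ⟨_, rfl⟩
  have hA : a = m * q + n * (-q') := by rw [hm, hn]; linear_combination (-a) * hdet
  have hB : b = m * p + n * (-p') := by rw [hm, hn]; linear_combination (-b) * hdet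
  have hne : ¬ (m = 0 ∧ n = 0) := by
    rintro ⟨rfl, rfl⟩
    exact hab (Prod.ext (by simpa using hA) (by simpa using hB))
  have h1 : ¬ (1 ≤ m ∧ n ≤ -1) := fun ⟨h1, h2⟩ => by nlinarith
  have h2 : ¬ (m ≤ -1 ∧ 1 ≤ n) := fun ⟨h1, h2⟩ => by nlinarith
  by_cases hpos : 0 ≤ m ∧ 0 ≤ n
  · obtain ⟨hm0, hn0⟩ := hpos
    lift m to ℕ using hm0
    lift n to ℕ using hn0
    exact ⟨m, n, by omega, Or.inl ⟨hA, hB⟩⟩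
  · obtain ⟨m', hm'⟩ := Int.eq_ofNat_of_zero_le (a := -m) (by omega)
    obtain ⟨n', hn'⟩ := Int.eq_ofNat_of_zero_le (a := -n) (by omega)
    refine ⟨m', n', by omega, Or.inr ⟨?_, ?_⟩⟩
    · rw [hA, ← hm', ← hn']; ring
    · rw [hB, ← hm', ← hn']; ring

/-- The affine form `(a, b) ↦ a α - b` is positive on the cone spanned by `(q, p)` and
`(-q', -p')`. -/
theorem mul_sub_pos_of_coords {p p' : ℤ} {q q' : ℕ} (hF : IsFareyInterval p q p' q') {α : ℝ}
    (hα : α ∈ Ioo ((p : ℝ) / q) ((p' : ℝ) / q')) {a b : ℤ} {m n : ℕ} (hmn : 0 < m + n)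
    (ha : a = m * q + n * (-q')) (hb : b = m * p + n * (-p')) : (0 : ℝ) < a * α - b := by
  have h1 : (0 : ℝ) < q * α - p := by
    have := (div_lt_iff₀ (by exact_mod_cast hF.1)).1 hα.1
    linarith
  have h2 : (0 : ℝ) < p' - q' * α := by
    have := (lt_div_iff₀ (by exact_mod_cast hF.2.1)).1 hα.2
    linarith
  have h3 : (a : ℝ) * α - b = m * (q * α - p) + n * (p' - q' * α) := by
    rw [ha, hb]; push_cast; ring
  rw [h3]
  rcases m.eq_zero_or_pos with rfl | hm
  · have : (0 : ℝ) < n := by exact_mod_cast (by omega : 0 < n)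
    simpa using mul_pos this h2
  · have : (0 : ℝ) < m := by exact_mod_cast hm
    positivity

/-- Any two distinct iterates among the first `q + q'` ones are comparable, and they are ordered
as the numbers `k α - ℓ`, whatever the choice of `α` in the Farey interval. -/
theorem arcLT_iterArc_or {G : Band ≃ₜ Band} (hG : Commute G T) {Γ : Set Band} (hΓ : IsBarrier Γ)
    {p p' : ℤ} {q q' : ℕ} (hF : IsFareyInterval p q p' q')
    (hleft : ArcLT (iterArc G Γ q' p') Γ) (hright : ArcLT Γ (iterArc G Γ q p))
    {k k' : ℕ} (hk : k ≤ q + q' - 1) (hk' : k' ≤ q + q' - 1) {ℓ ℓ' : ℤ}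
    (hne : (k, ℓ) ≠ (k', ℓ')) :
    (ArcLT (iterArc G Γ k ℓ) (iterArc G Γ k' ℓ') ∧
      ∀ α ∈ Ioo ((p : ℝ) / q) ((p' : ℝ) / q'), (k : ℝ) * α - ℓ < k' * α - ℓ') ∨
    (ArcLT (iterArc G Γ k' ℓ') (iterArc G Γ k ℓ) ∧
      ∀ α ∈ Ioo ((p : ℝ) / q) ((p' : ℝ) / q'), (k' : ℝ) * α - ℓ' < k * α - ℓ) := by
  simp only [iterArc_eq] at hleft hright ⊢
  have hleft' : ArcLT Γ (gridMap G (-q') (-p') '' Γ) := by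
    have h1 := hleft.image (commute_gridMap hG (-q') (-p'))
    rw [← mul_image, ← gridMap_add hG, neg_add_cancel, neg_add_cancel, gridMap_zero_image] at h1
    exact h1
  have key (i j i' j' : ℤ) (m n : ℕ) (hmn : 0 < m + n) (ha : i' - i = m * q + n * (-q'))
      (hb : j' - j = m * p + n * (-p')) :
      ArcLT (gridMap G i j '' Γ) (gridMap G i' j' '' Γ) ∧
        ∀ α ∈ Ioo ((p : ℝ) / q) ((p' : ℝ) / q'), (i : ℝ) * α - j < i' * α - j' := by
    constructor
    · have h1 := (arcLT_gridMap_nsmul_add hG hΓ hright hleft' m n hmn).image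
        (commute_gridMap hG i j)
      rwa [← mul_image, ← gridMap_add hG, ← ha, ← hb, add_sub_cancel, add_sub_cancel] at h1
    · intro α hα
      have := mul_sub_pos_of_coords hF hα hmn ha hb
      push_cast at this
      linarith
  have hq := hF.1
  obtain ⟨m, n, hmn, ⟨ha, hb⟩ | ⟨ha, hb⟩⟩ := exists_nat_coords hF
    (a := (k' : ℤ) - k) (b := ℓ' - ℓ) (by rw [abs_lt]; constructor <;> omega) (by
      intro h0
      rw [Prod.mk_eq_zero] at h0
      exact hne (Prod.ext (show k = k' by omega) (show ℓ = ℓ' by omega)))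
  · exact Or.inl (by simpa using key k ℓ k' ℓ' m n hmn ha hb)
  · rw [neg_sub] at ha hb
    exact Or.inr (by simpa using key k' ℓ' k ℓ m n hmn ha hb)

end FareyArcs

theorem mainTheorem9
    (h : FareyArcs.Annulus ≃ₜ FareyArcs.Annulus) (hh : FareyArcs.IsotopicToId h)
    (g : FareyArcs.Band → FareyArcs.Band) (hg : FareyArcs.IsLift g h)
    (Γ : Set FareyArcs.Band) (hΓ : FareyArcs.IsEssentialArc Γ)
    (p : ℤ) (q : ℕ) (p' : ℤ) (q' : ℕ) (hF : FareyArcs.IsFareyInterval p q p' q')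
    (hleft : FareyArcs.ArcLT (FareyArcs.iterArc g Γ q' p') Γ)
    (hright : FareyArcs.ArcLT Γ (FareyArcs.iterArc g Γ q p)) :
    (∀ k k' : ℕ, k ≤ q + q' - 1 → k' ≤ q + q' - 1 → ∀ ℓ ℓ' : ℤ, (k, ℓ) ≠ (k', ℓ') →
      Disjoint (FareyArcs.iterArc g Γ k ℓ) (FareyArcs.iterArc g Γ k' ℓ')) ∧
    (∀ α : ℝ, α ∈ Set.Ioo ((p : ℝ) / (q : ℝ)) ((p' : ℝ) / (q' : ℝ)) →
      ∀ k k' : ℕ, k ≤ q + q' - 1 → k' ≤ q + q' - 1 → ∀ ℓ ℓ' : ℤ,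
        (FareyArcs.ArcLT (FareyArcs.iterArc g Γ k ℓ) (FareyArcs.iterArc g Γ k' ℓ') ↔
          (k : ℝ) * α - (ℓ : ℝ) < (k' : ℝ) * α - (ℓ' : ℝ))) := by
  obtain ⟨G, rfl, hG⟩ := hg.exists_homeomorph hh
  have hB := hΓ.isBarrier
  have hBI (k : ℕ) (ℓ : ℤ) : FareyArcs.IsBarrier (FareyArcs.iterArc G Γ k ℓ) := by
    rw [FareyArcs.iterArc_eq]
    exact hB.image (FareyArcs.commute_gridMap hG k ℓ)
  constructor
  · intro k k' hk hk' ℓ ℓ' hne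
    rcases FareyArcs.arcLT_iterArc_or hG hB hF hleft hright hk hk' hne with ⟨h1, -⟩ | ⟨h1, -⟩
    · exact h1.disjoint
    · exact h1.disjoint.symm
  · intro α hα k k' hk hk' ℓ ℓ'
    by_cases heq : (k, ℓ) = (k', ℓ')
    · obtain ⟨rfl, rfl⟩ := Prod.mk.inj heq
      exact iff_of_false (FareyArcs.not_arcLT_self (hBI k ℓ).isConnected.nonempty) (lt_irrefl _)
    · rcases FareyArcs.arcLT_iterArc_or hG hB hF hleft hright hk hk' heq with
        ⟨h1, h2⟩ | ⟨h1, h2⟩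
      · exact iff_of_true h1 (h2 α hα)
      · exact iff_of_false (h1.asymm (hBI k' ℓ') (hBI k ℓ)) (h2 α hα).not_gt
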